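/- All graphs are finite and simple, and $\mathbb{K}$ is a field. A cut $A|B=B|A$ of a graph $G$ is an unordered partition of $V(G)$ into two parts, one of which may be empty; an edge $ij$ is in $A|B$ if $i$ and $j$ lie in different parts. The cut ideal $I_G$ is the kernel of the $\mathbb{K}$-algebra homomorphism $$\phi_G:\mathbb{K}[q_{A|B} : A|B \text{ a cut of } G]\to \mathbb{K}[s_{ij},t_{ij} : ij\in E(G)],\qquad q_{A|B}\mapsto \prod_{ij \text{ in } A|B} s_{ij}\prod_{ij\text{ not in } A|B} t_{ij}.$$ Let $\mu(G)$ be the largest degree of a minimal generator of $I_G$, that is, of an element of a minimal homogeneous generating set of $I_G$ (and $\mu(G)=0$ if $I_G=0$). Let $H_1$ and $H_2$ be connected graphs on disjoint vertex sets and, for $i=1,2$, let $u_i,v_i$ be two distinct non-adjacent vertices of $H_i$. Suppose that $$\mu(H_1),\ \mu(H_2),\ \mu(H_1+u_1v_1),\ \mu(H_2+u_2v_2)\le 2,$$ where $H_i+u_iv_i$ is $H_i$ with the edge $u_iv_i$ added. Let $G$ be the graph obtained from $H_1\cup H_2$ by gluing $u_1=u_2$ and $v_1=v_2$. Then $\mu(G)\le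 2$, and $I_G$ is generated by quadrics, i.e. by homogeneous polynomials of degree $2$. -/

import Mathlib

/-- A cut `A | B = B | A` of a graph with vertex set `V`: an unordered partition of `V` into two
parts (one of which may be empty). -/
def Cut (V : Type*) : Type _ :=
  {p : Sym2 (Set V) // ∃ A : Set V, p = s(A, Aᶜ)}

/-- The edge `e` joins the two parts of the cut `c = A | B`, i.e. `e = ab` with `a ∈ A`, `b ∈ B`. -/
def Cut.Separates {V : Type*} (c : Cut V) (e : Sym2 V) : Prop :=
  ∃ A B : Set V, c.1 = s(A, B) ∧ ∃ a ∈ A, ∃ b ∈ B, e = s(a, b)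

open Classical in
/-- The ring homomorphism `φ_G : K[q] → K[s, t]` of a finite graph `G`. It sends `q_{A|B}` to the
product of the `s_{ij}` over the edges `ij` in the cut `A | B` and the `t_{ij}` over the edges `ij`
not in the cut. The variable `s_{ij}` is `X (Sum.inl ij)` and `t_{ij}` is `X (Sum.inr ij)`. -/
noncomputable def cutMap (K : Type*) [Field K] {V : Type*} [Finite V] (G : SimpleGraph V) :
    MvPolynomial (Cut V) K →ₐ[K] MvPolynomial (G.edgeSet ⊕ G.edgeSet) K :=
  MvPolynomial.aeval fun c : Cut V =>
    ∏ᶠ e : G.edgeSet,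
      if c.Separates e.1 then MvPolynomial.X (Sum.inl e) else MvPolynomial.X (Sum.inr e)

/-- The cut ideal `I_G`, the kernel of `φ_G`. -/
noncomputable def cutIdeal (K : Type*) [Field K] {V : Type*} [Finite V] (G : SimpleGraph V) :
    Ideal (MvPolynomial (Cut V) K) :=
  RingHom.ker (cutMap K G)

/-- `S` is a minimal set of homogeneous generators of the ideal `I` of a polynomial ring. -/
def IsMinimalHomogeneousGenerators {σ K : Type*} [Field K] (I : Ideal (MvPolynomial σ K))
    (S : Set (MvPolynomial σ K)) : Prop :=
  Minimal (fun T : Set (MvPolynomial σ K) =>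
    (∀ f ∈ T, ∃ d : ℕ, f.IsHomogeneous d) ∧ Ideal.span T = I) S

/-- `μ(G)`, the largest degree of a minimal generator of the cut ideal of `G`. The supremum is
taken in `ℕ∞`; it is `0` if the cut ideal is zero. -/
noncomputable def cutMu (K : Type*) [Field K] {V : Type*} [Finite V] (G : SimpleGraph V) : ℕ∞ :=
  ⨆ (S : Set (MvPolynomial (Cut V) K))
    (_ : IsMinimalHomogeneousGenerators (cutIdeal K G) S) (f ∈ S), (f.totalDegree : ℕ∞)

/-- The identifications `u₁ = u₂` and `v₁ = v₂` in the disjoint union of `V₁` and `V₂`. -/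
inductive GlueRel {V₁ V₂ : Type*} (u₁ v₁ : V₁) (u₂ v₂ : V₂) : V₁ ⊕ V₂ → V₁ ⊕ V₂ → Prop
  | left : GlueRel u₁ v₁ u₂ v₂ (Sum.inl u₁) (Sum.inr u₂)
  | right : GlueRel u₁ v₁ u₂ v₂ (Sum.inl v₁) (Sum.inr v₂)

/-- The vertex set obtained from the disjoint union of `V₁` and `V₂` by gluing `u₁ = u₂` and
`v₁ = v₂`. -/
def GlueVertex {V₁ V₂ : Type*} (u₁ v₁ : V₁) (u₂ v₂ : V₂) : Type _ :=
  Quot (GlueRel u₁ v₁ u₂ v₂)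

instance GlueVertex.instFinite {V₁ V₂ : Type*} [Finite V₁] [Finite V₂] (u₁ v₁ : V₁) (u₂ v₂ : V₂) :
    Finite (GlueVertex u₁ v₁ u₂ v₂) :=
  inferInstanceAs (Finite (Quot (GlueRel u₁ v₁ u₂ v₂)))

/-- The graph obtained from the disjoint union of `H₁` and `H₂` by gluing `u₁ = u₂` and
`v₁ = v₂`: its edges are the images of the edges of `H₁` and of `H₂`. -/
def glueGraph {V₁ V₂ : Type*} (H₁ : SimpleGraph V₁) (H₂ : SimpleGraph V₂)
    (u₁ v₁ : V₁) (u₂ v₂ : V₂) : SimpleGraph (GlueVertex u₁ v₁ u₂ v₂) :=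
  SimpleGraph.map (Quot.mk (GlueRel u₁ v₁ u₂ v₂)) (SimpleGraph.sum H₁ H₂)

/-! Monomials in the variables `q` are multisets of cuts, and two of them have the same image when
they have the same size and every edge is separated equally often (`toricFiber_cutExponent`).
Generation by quadrics becomes connectedness of these fibres under replacing two cuts at a time;
`quadConn_of_ker_eq_span` reads this off the hypotheses and `ker_toricMap_eq_span_quadrics` turns it
back into generators.

A cut of $G$ is a pair of cuts of $H_1$ and $H_2$ that agree on whether $u,v$ are separated. Let $n$
be the number of cuts in a multiset that separate $u,v$. The hypothesis on $H_i+u_iv_i$ connects the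
parts of fibres with $n$ fixed, and such paths lift to $G$ without disturbing the other side
(`QuadConn.exists_lift`).

The hypothesis on $H_i$ lets $n$ vary. As $H_i$ is connected, the parity of $n$ is constant on
fibres (`CutFiber.countP_modEq`), so a path that raises $n$ must somewhere trade two non-separating
cuts for two separating ones. Paths with $n$ fixed bring both sides to the start of such a trade,
and the two trades together form one quadratic move of $G$ (`QuadConn.exists_lift_pair`). Repeating
this equalises $n$, and the case of fixed $n$ finishes (`QuadConn.fiberProduct`). -/

/-! ### Quadratic moves on multisets. -/

/-- A quadratic move: two elements of a multiset are replaced by two elements of the same fibre. -/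
def QuadStep {σ : Type*} (R : Multiset σ → Multiset σ → Prop) (s t : Multiset σ) : Prop :=
  ∃ r x y, x.card = 2 ∧ y.card = 2 ∧ R x y ∧ s = r + x ∧ t = r + y

/-- Two multisets are connected by quadratic moves. -/
abbrev QuadConn {σ : Type*} (R : Multiset σ → Multiset σ → Prop) :
    Multiset σ → Multiset σ → Prop :=
  Relation.ReflTransGen (QuadStep R)

theorem Multiset.exists_add_of_map_eq_add {α β : Type*} {f : α → β} {r : Multiset β} :
    ∀ {s : Multiset α} {x : Multiset β}, s.map f = r + x →
      ∃ s₁ s₂, s = s₁ + s₂ ∧ s₁.map f = r ∧ s₂.map f = x := by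
  classical
  induction r using Multiset.induction with
  | empty => exact fun {s x} h => ⟨0, s, by simp, rfl, by simpa using h⟩
  | cons b r ih =>
    intro s x h
    rw [Multiset.cons_add, ← Multiset.map_eq_cons] at h
    obtain ⟨a, ha, rfl, h⟩ := h
    obtain ⟨s₁, s₂, h', rfl, rfl⟩ := ih h
    exact ⟨a ::ₘ s₁, s₂, by rw [Multiset.cons_add, ← h', Multiset.cons_erase ha], by simp, rfl⟩

section QuadConn

variable {σ : Type*} {R : Multiset σ → Multiset σ → Prop}

theorem QuadStep.add_left (r : Multiset σ) {s t : Multiset σ} (h : QuadStep R s t) :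
    QuadStep R (r + s) (r + t) := by
  obtain ⟨q, x, y, hx, hy, hR, rfl, rfl⟩ := h
  exact ⟨r + q, x, y, hx, hy, hR, (add_assoc _ _ _).symm, (add_assoc _ _ _).symm⟩

theorem QuadConn.add_left (r : Multiset σ) {s t : Multiset σ} (h : QuadConn R s t) :
    QuadConn R (r + s) (r + t) :=
  Relation.ReflTransGen.lift (r + ·) (fun _ _ => QuadStep.add_left r) _ _ h

theorem QuadConn.symm (hR : ∀ x y, R x y → R y x) {s t : Multiset σ} (h : QuadConn R s t) :
    QuadConn R t s := by
  induction h with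
  | refl => exact .refl
  | tail _ h ih =>
    obtain ⟨r, x, y, hx, hy, h, rfl, rfl⟩ := h
    exact .head ⟨r, y, x, hy, hx, hR _ _ h, rfl, rfl⟩ ih

theorem QuadConn.fiber (hrefl : ∀ x, R x x) (htrans : ∀ x y z, R x y → R y z → R x z)
    (hadd : ∀ r x y, R x y → R (r + x) (r + y)) {s t : Multiset σ} (h : QuadConn R s t) :
    R s t := by
  induction h with
  | refl => exact hrefl _
  | tail _ h ih =>
    obtain ⟨r, x, y, _, _, hR, rfl, rfl⟩ := h
    exact htrans _ _ _ ih (hadd _ _ _ hR)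

open Classical in
/-- If the parity of the number of elements with property `π` is constant on fibres, a path of
quadratic moves that raises this number above `n` passes through a move from `n` to `n + 2`. -/
theorem QuadConn.exists_step_countP (π : σ → Prop)
    (hpar : ∀ x y, R x y → x.countP π ≡ y.countP π [MOD 2])
    {s t : Multiset σ} {n : ℕ} (h : QuadConn R s t) (hs : s.countP π ≤ n)
    (hsn : s.countP π ≡ n [MOD 2]) (ht : n < t.countP π) :
    ∃ r x y, QuadConn R s (r + x) ∧ x.card = 2 ∧ y.card = 2 ∧ R x y ∧
      (r + x).countP π = n ∧ x.countP π = 0 ∧ y.countP π = 2 := by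
  induction h using Relation.ReflTransGen.head_induction_on with
  | refl => omega
  | head h _ ih =>
    obtain ⟨r, x, y, hx, hy, hR, rfl, rfl⟩ := h
    have hp := hpar _ _ hR
    have h1 := Multiset.countP_le_card π x
    have h2 := Multiset.countP_le_card π y
    simp only [Multiset.countP_add, Nat.ModEq] at *
    -- By parity and since a pair contributes at most 2, the first move past `n` starts exactly at
    -- `n` and takes a pair with count 0 to one with count 2.
    by_cases hn : r.countP π + y.countP π ≤ n
    · obtain ⟨r', x', y', hc, hrest⟩ := ih hn (by omega)
      exact ⟨r', x', y', .head ⟨r, x, y, hx, hy, hR, rfl, rfl⟩ hc, hrest⟩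
    · exact ⟨r, x, y, .refl, hx, hy, hR, by omega, by omega, by omega⟩

end QuadConn

/-! ### Connectedness of fibres in a fibre product. -/

/-- `σ` is the fibre product of `σ₁` and `σ₂` over the truth values of `π₁` and `π₂`. -/
structure IsPropFiberProduct {σ σ₁ σ₂ : Type*} (p₁ : σ → σ₁) (p₂ : σ → σ₂)
    (π₁ : σ₁ → Prop) (π₂ : σ₂ → Prop) : Prop where
  compat : ∀ c, π₁ (p₁ c) ↔ π₂ (p₂ c)
  exists_lift : ∀ a b, (π₁ a ↔ π₂ b) → ∃ c, p₁ c = a ∧ p₂ c = b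
  injective : ∀ c d, p₁ c = p₁ d → p₂ c = p₂ d → c = d

section FiberProduct

variable {σ σ₁ σ₂ : Type*} {p₁ : σ → σ₁} {p₂ : σ → σ₂} {π₁ : σ₁ → Prop} {π₂ : σ₂ → Prop}

theorem IsPropFiberProduct.swap (hp : IsPropFiberProduct p₁ p₂ π₁ π₂) :
    IsPropFiberProduct p₂ p₁ π₂ π₁ where
  compat c := (hp.compat c).symm
  exists_lift a b h := (hp.exists_lift b a h.symm).imp fun _ => And.symm
  injective c d h h' := hp.injective c d h' h

open Classical in
theorem IsPropFiberProduct.countP_eq (hp : IsPropFiberProduct p₁ p₂ π₁ π₂) (M : Multiset σ) :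
    (M.map p₁).countP π₁ = (M.map p₂).countP π₂ := by
  simp [Multiset.countP_map, hp.compat]

-- Greedy matching: with equal sizes and equal counts, each element of `α` has a partner in `β` with
-- the same truth value, and removing both keeps the balance.
open Classical in
theorem IsPropFiberProduct.exists_of_marginals (hp : IsPropFiberProduct p₁ p₂ π₁ π₂)
    (α : Multiset σ₁) : ∀ β : Multiset σ₂, α.card = β.card → α.countP π₁ = β.countP π₂ →
      ∃ M : Multiset σ, M.map p₁ = α ∧ M.map p₂ = β := by
  induction α using Multiset.induction with
  | empty =>
    intro β h _
    exact ⟨0, rfl, (Multiset.card_eq_zero.1 (by simpa using h.symm)).symm⟩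
  | cons a α ih =>
    intro β hcard hcount
    have hb : ∃ b ∈ β, (π₁ a ↔ π₂ b) := by
      by_contra! hcon
      by_cases ha : π₁ a
      · have h0 : β.countP π₂ = 0 := Multiset.countP_eq_zero.2 fun b hb hb' => by
          have := hcon b hb; tauto
        rw [Multiset.countP_cons_of_pos _ ha] at hcount
        omega
      · have h0 : β.countP π₂ = β.card := Multiset.countP_eq_card.2 fun b hb => by
          have := hcon b hb; tauto
        rw [Multiset.countP_cons_of_neg _ ha] at hcount
        have := Multiset.countP_le_card π₁ α
        rw [Multiset.card_cons] at hcard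
        omega
    obtain ⟨b, hb, hab⟩ := hb
    obtain ⟨β, rfl⟩ := Multiset.exists_cons_of_mem hb
    obtain ⟨M, rfl, rfl⟩ := ih β (by simpa using hcard) (by
      simp only [Multiset.countP_cons, hab] at hcount
      omega)
    obtain ⟨c, rfl, rfl⟩ := hp.exists_lift a b hab
    exact ⟨c ::ₘ M, by simp, by simp⟩

/-- These are the Segre-type moves. One element of `M'` has the first coordinate of `c`, another the
second; all truth values involved agree with that of `c`, so swapping coordinates between the two
creates `c`. -/
theorem QuadConn.of_marginals_eq {R : Multiset σ → Multiset σ → Prop}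
    (hp : IsPropFiberProduct p₁ p₂ π₁ π₂)
    (hR : ∀ x y : Multiset σ, x.map p₁ = y.map p₁ → x.map p₂ = y.map p₂ → R x y)
    (M : Multiset σ) : ∀ M' : Multiset σ, M'.map p₁ = M.map p₁ → M'.map p₂ = M.map p₂ →
      QuadConn R M' M := by
  classical
  induction M using Multiset.induction with
  | empty =>
    intro M' h _
    rw [Multiset.map_zero, Multiset.map_eq_zero] at h
    rw [h]
  | cons c M ih =>
    intro M' h₁ h₂
    obtain ⟨d, hd, hdc⟩ : ∃ d ∈ M', p₁ d = p₁ c := by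
      rw [← Multiset.mem_map, h₁]; simp
    obtain ⟨e, he, hec⟩ : ∃ e ∈ M', p₂ e = p₂ c := by
      rw [← Multiset.mem_map, h₂]; simp
    obtain ⟨N, rfl⟩ := Multiset.exists_cons_of_mem hd
    by_cases hde : e = d
    · subst hde
      obtain rfl := hp.injective _ _ hdc hec
      have := ih N (by simpa using h₁) (by simpa using h₂)
      simpa only [Multiset.singleton_add] using this.add_left {e}
    · obtain ⟨N, rfl⟩ := Multiset.exists_cons_of_mem ((Multiset.mem_cons.1 he).resolve_left hde)
      obtain ⟨c', hc₁, hc₂⟩ := hp.exists_lift (p₁ e) (p₂ d) (by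
        rw [hp.compat e, ← hp.compat d, hdc, hec, hp.compat c])
      have hc := ih (c' ::ₘ N)
        (by
          have : p₁ e ::ₘ N.map p₁ = M.map p₁ := by simpa [hdc] using h₁
          simpa [hc₁] using this)
        (by
          have : p₂ d ::ₘ N.map p₂ = M.map p₂ := by
            simpa [hec, Multiset.cons_swap (p₂ d)] using h₂
          simpa [hc₂] using this)
      refine .head ⟨N, {d, e}, {c, c'}, rfl, rfl, hR _ _ ?_ ?_, ?_, rfl⟩ ?_
      · simp [hdc, hc₁]
      · simp only [Multiset.insert_eq_cons, Multiset.map_cons, Multiset.map_singleton, hec, hc₂]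
        exact Multiset.pair_comm _ _
      · rw [add_comm, Multiset.insert_eq_cons, Multiset.cons_add, Multiset.singleton_add]
      · have := hc.add_left {c}
        rw [Multiset.singleton_add, Multiset.singleton_add] at this
        rwa [add_comm, Multiset.insert_eq_cons, Multiset.cons_add, Multiset.singleton_add]

-- Equal counts allow `x₁` to be matched with `x₂`, `y₁` with `y₂`, and the remainders with each
-- other. After re-pairing `M` accordingly, both moves happen in a single quadratic move.
open Classical in
theorem QuadConn.exists_lift_pair {R : Multiset σ → Multiset σ → Prop}
    {R₁ : Multiset σ₁ → Multiset σ₁ → Prop} {R₂ : Multiset σ₂ → Multiset σ₂ → Prop}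
    (hp : IsPropFiberProduct p₁ p₂ π₁ π₂)
    (hR₁ : ∀ x, R₁ x x) (hR₂ : ∀ x, R₂ x x)
    (hR : ∀ x y, R x y ↔ R₁ (x.map p₁) (y.map p₁) ∧ R₂ (x.map p₂) (y.map p₂))
    {M : Multiset σ} {r₁ x₁ y₁ : Multiset σ₁} {r₂ x₂ y₂ : Multiset σ₂}
    (h₁ : M.map p₁ = r₁ + x₁) (h₂ : M.map p₂ = r₂ + x₂)
    (hx₁ : x₁.card = 2) (hx₂ : x₂.card = 2) (hy₁ : y₁.card = 2) (hy₂ : y₂.card = 2)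
    (hxy₁ : R₁ x₁ y₁) (hxy₂ : R₂ x₂ y₂) (hx : x₁.countP π₁ = x₂.countP π₂)
    (hy : y₁.countP π₁ = y₂.countP π₂) :
    ∃ M', QuadConn R M M' ∧ M'.map p₁ = r₁ + y₁ ∧ M'.map p₂ = r₂ + y₂ := by
  have hcount := hp.countP_eq M
  have hcard₁ := congrArg Multiset.card h₁
  have hcard₂ := congrArg Multiset.card h₂
  rw [h₁, h₂, Multiset.countP_add, Multiset.countP_add] at hcount
  rw [Multiset.card_map, Multiset.card_add] at hcard₁ hcard₂
  obtain ⟨X, rfl, rfl⟩ := hp.exists_of_marginals x₁ x₂ (by omega) hx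
  obtain ⟨Y, rfl, rfl⟩ := hp.exists_of_marginals y₁ y₂ (by omega) hy
  obtain ⟨Z, rfl, rfl⟩ := hp.exists_of_marginals r₁ r₂ (by omega) (by omega)
  refine ⟨Z + Y, .tail (b := Z + X) ?_ ?_, Multiset.map_add .., Multiset.map_add ..⟩
  · refine QuadConn.of_marginals_eq hp (fun x y h h' => (hR x y).2 ?_) _ _
      (by rw [h₁, Multiset.map_add]) (by rw [h₂, Multiset.map_add])
    rw [h, h']
    exact ⟨hR₁ _, hR₂ _⟩
  · exact ⟨Z, X, Y, by simpa using hx₁, by simpa using hy₁, (hR _ _).2 ⟨hxy₁, hxy₂⟩, rfl, rfl⟩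

-- A move of the first factor that preserves the count is paired with the trivial move on the second
-- coordinates of the same two elements.
open Classical in
theorem QuadConn.exists_lift {R : Multiset σ → Multiset σ → Prop}
    {R₁ : Multiset σ₁ → Multiset σ₁ → Prop} {R₂ : Multiset σ₂ → Multiset σ₂ → Prop}
    (hp : IsPropFiberProduct p₁ p₂ π₁ π₂)
    (hR₁ : ∀ x, R₁ x x) (hR₂ : ∀ x, R₂ x x)
    (hR : ∀ x y, R x y ↔ R₁ (x.map p₁) (y.map p₁) ∧ R₂ (x.map p₂) (y.map p₂))
    {M : Multiset σ} {α : Multiset σ₁}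
    (h : QuadConn (fun x y => R₁ x y ∧ x.countP π₁ = y.countP π₁) (M.map p₁) α) :
    ∃ M', QuadConn R M M' ∧ M'.map p₁ = α ∧ M'.map p₂ = M.map p₂ := by
  induction h with
  | refl => exact ⟨M, .refl, rfl, rfl⟩
  | tail _ hs ih =>
    obtain ⟨N, hN, h₁, h₂⟩ := ih
    obtain ⟨r, x, y, hx, hy, ⟨hR', hc⟩, rfl, rfl⟩ := hs
    obtain ⟨N₁, N₂, rfl, rfl, rfl⟩ := Multiset.exists_add_of_map_eq_add h₁
    rw [Multiset.card_map] at hx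
    obtain ⟨N', hN', h₁', h₂'⟩ := QuadConn.exists_lift_pair hp hR₁ hR₂ hR (Multiset.map_add p₁ _ _)
      (Multiset.map_add p₂ _ _) (by simpa using hx) (by simpa using hx) hy
      (by simpa using hx) hR' (hR₂ _) (hp.countP_eq _) (by rw [← hc, hp.countP_eq])
    exact ⟨N', hN.trans hN', h₁', by rw [h₂', ← Multiset.map_add, h₂]⟩

open Classical in
/-- If the fibres of `R₁` and `R₂`, and the parts of them with a fixed number of elements
satisfying `π₁` and `π₂`, are connected by quadratic moves, then so are the fibres of the fibre
product. -/
theorem QuadConn.fiberProduct {R : Multiset σ → Multiset σ → Prop}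
    {R₁ : Multiset σ₁ → Multiset σ₁ → Prop} {R₂ : Multiset σ₂ → Multiset σ₂ → Prop}
    (hp : IsPropFiberProduct p₁ p₂ π₁ π₂)
    (hE₁ : Equivalence R₁) (hE₂ : Equivalence R₂)
    (hadd₁ : ∀ r x y, R₁ x y → R₁ (r + x) (r + y)) (hadd₂ : ∀ r x y, R₂ x y → R₂ (r + x) (r + y))
    (hpar₁ : ∀ x y, R₁ x y → x.countP π₁ ≡ y.countP π₁ [MOD 2])
    (hpar₂ : ∀ x y, R₂ x y → x.countP π₂ ≡ y.countP π₂ [MOD 2])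
    (hR : ∀ x y, R x y ↔ R₁ (x.map p₁) (y.map p₁) ∧ R₂ (x.map p₂) (y.map p₂))
    (hc₁ : ∀ x y, R₁ x y → QuadConn R₁ x y) (hc₂ : ∀ x y, R₂ x y → QuadConn R₂ x y)
    (hc₁' : ∀ x y, R₁ x y → x.countP π₁ = y.countP π₁ →
      QuadConn (fun x y => R₁ x y ∧ x.countP π₁ = y.countP π₁) x y)
    (hc₂' : ∀ x y, R₂ x y → x.countP π₂ = y.countP π₂ →
      QuadConn (fun x y => R₂ x y ∧ x.countP π₂ = y.countP π₂) x y)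
    {M M' : Multiset σ} (h : R M M') : QuadConn R M M' := by
  have hE : Equivalence R :=
    ⟨fun x => (hR _ _).2 ⟨hE₁.refl _, hE₂.refl _⟩,
      fun {x y} h => (hR _ _).2 (((hR _ _).1 h).imp hE₁.symm hE₂.symm),
      fun {x y z} h h' => (hR _ _).2 ⟨hE₁.trans ((hR _ _).1 h).1 ((hR _ _).1 h').1,
        hE₂.trans ((hR _ _).1 h).2 ((hR _ _).1 h').2⟩⟩
  have hadd : ∀ r x y, R x y → R (r + x) (r + y) := fun r x y h => by
    rw [hR] at h ⊢
    simp only [Multiset.map_add]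
    exact ⟨hadd₁ _ _ _ h.1, hadd₂ _ _ _ h.2⟩
  have hswap : ∀ x y, R x y ↔ R₂ (x.map p₂) (y.map p₂) ∧ R₁ (x.map p₁) (y.map p₁) :=
    fun x y => (hR x y).trans and_comm
  have lift₁ : ∀ (M : Multiset σ) (α : Multiset σ₁), R₁ (M.map p₁) α →
      (M.map p₁).countP π₁ = α.countP π₁ →
      ∃ M', QuadConn R M M' ∧ M'.map p₁ = α ∧ M'.map p₂ = M.map p₂ := fun M α h h' =>
    QuadConn.exists_lift hp hE₁.refl hE₂.refl hR (hc₁' _ _ h h')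
  have lift₂ : ∀ (M : Multiset σ) (β : Multiset σ₂), R₂ (M.map p₂) β →
      (M.map p₂).countP π₂ = β.countP π₂ →
      ∃ M', QuadConn R M M' ∧ M'.map p₂ = β ∧ M'.map p₁ = M.map p₁ := fun M β h h' =>
    QuadConn.exists_lift hp.swap hE₂.refl hE₁.refl hswap (hc₂' _ _ h h')
  -- The trades found on the two sides both start at the count of `M`, so each starting point is
  -- reachable by moves of fixed count, one side after the other.
  have raise : ∀ M M' : Multiset σ, R M M' →
      (M.map p₁).countP π₁ < (M'.map p₁).countP π₁ →
      ∃ N, QuadConn R M N ∧ (N.map p₁).countP π₁ = (M.map p₁).countP π₁ + 2 := by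
    intro M M' h hlt
    have hlt₂ := hlt
    rw [hp.countP_eq, hp.countP_eq] at hlt₂
    obtain ⟨r₁, x₁, y₁, hq₁, hx₁, hy₁, hxy₁, hn₁, hx₁', hy₁'⟩ :=
      (hc₁ _ _ ((hR _ _).1 h).1).exists_step_countP π₁ hpar₁ le_rfl rfl hlt
    obtain ⟨r₂, x₂, y₂, hq₂, hx₂, hy₂, hxy₂, hn₂, hx₂', hy₂'⟩ :=
      (hc₂ _ _ ((hR _ _).1 h).2).exists_step_countP π₂ hpar₂ le_rfl rfl hlt₂
    obtain ⟨N₁, hN₁, hN₁₁, hN₁₂⟩ := lift₁ M (r₁ + x₁)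
      (hq₁.fiber hE₁.refl (fun _ _ _ => hE₁.trans) hadd₁) hn₁.symm
    obtain ⟨N₂, hN₂, hN₂₂, hN₂₁⟩ := lift₂ N₁ (r₂ + x₂)
      (by rw [hN₁₂]; exact hq₂.fiber hE₂.refl (fun _ _ _ => hE₂.trans) hadd₂)
      (by rw [hN₁₂, hn₂])
    obtain ⟨N₃, hN₃, hN₃₁, -⟩ := QuadConn.exists_lift_pair hp hE₁.refl hE₂.refl hR
      (hN₂₁.trans hN₁₁) hN₂₂ hx₁ hx₂ hy₁ hy₂ hxy₁ hxy₂ (by omega) (by omega)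
    refine ⟨N₃, (hN₁.trans hN₂).trans hN₃, ?_⟩
    rw [hN₃₁, ← hn₁, Multiset.countP_add, Multiset.countP_add]
    omega
  have hfib : ∀ {x y}, QuadConn R x y → R x y := fun h =>
    h.fiber hE.refl (fun _ _ _ => hE.trans) hadd
  have key : ∀ (n : ℕ) (M M' : Multiset σ), R M M' →
      (M'.map p₁).countP π₁ = (M.map p₁).countP π₁ + n → QuadConn R M M' := by
    intro n
    induction n using Nat.strong_induction_on with
    | _ n ih =>
    intro M M' h hn
    rcases Nat.eq_zero_or_pos n with rfl | hpos
    · obtain ⟨N₁, hN₁, hN₁₁, hN₁₂⟩ := lift₁ M (M'.map p₁) ((hR _ _).1 h).1 hn.symm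
      obtain ⟨N₂, hN₂, hN₂₂, hN₂₁⟩ := lift₂ N₁ (M'.map p₂)
        (by rw [hN₁₂]; exact ((hR _ _).1 h).2)
        (by rw [hN₁₂, ← hp.countP_eq, ← hp.countP_eq]; exact hn.symm)
      refine (hN₁.trans hN₂).trans (QuadConn.of_marginals_eq hp (fun x y h h' => (hR x y).2 ?_) _ _
        (hN₂₁.trans hN₁₁) hN₂₂)
      rw [h, h']
      exact ⟨hE₁.refl _, hE₂.refl _⟩
    · obtain ⟨N, hN, hN'⟩ := raise M M' h (by omega)
      -- The positive excess `n` is even, so `n - 2` is not truncated.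
      have hpar := hpar₁ _ _ ((hR _ _).1 h).1
      rw [Nat.ModEq] at hpar
      exact hN.trans (ih (n - 2) (by omega) N M' (hE.trans (hE.symm (hfib hN)) h) (by omega))
  rcases le_total ((M.map p₁).countP π₁) ((M'.map p₁).countP π₁) with hle | hle
  · exact key _ M M' h (Nat.add_sub_cancel' hle).symm
  · exact (key _ M' M (hE.symm h) (Nat.add_sub_cancel' hle).symm).symm fun _ _ => hE.symm

end FiberProduct

/-! ### Toric ideals and quadratic moves. -/

open MvPolynomial in
open Classical in
/-- The monomials, indexed by multisets of variables, as a basis of the polynomial ring. -/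
noncomputable def multisetMonomial (σ K : Type*) [Field K] :
    Module.Basis (Multiset σ) K (MvPolynomial σ K) :=
  (basisMonomials σ K).reindex Multiset.toFinsupp.symm.toEquiv

/-- Two multisets of variables have monomials with the same image under the toric map with
exponents `A`. -/
def ToricFiber {σ τ : Type*} (A : σ → τ →₀ ℕ) (s t : Multiset σ) : Prop :=
  (s.map A).sum = (t.map A).sum

open MvPolynomial in
/-- The homomorphism of polynomial rings that sends the variable `c` to the monomial with
exponent `A c`. -/
noncomputable def toricMap (K : Type*) [Field K] {σ τ : Type*} (A : σ → τ →₀ ℕ) :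
    MvPolynomial σ K →ₐ[K] MvPolynomial τ K :=
  aeval fun c => monomial (A c) 1

section Toric

open MvPolynomial

variable {σ τ K : Type*} [Field K]

theorem multisetMonomial_toMultiset (m : σ →₀ ℕ) :
    multisetMonomial σ K (Finsupp.toMultiset m) = monomial m 1 := by
  classical
  simp [multisetMonomial]

theorem multisetMonomial_eq_prod (s : Multiset σ) :
    multisetMonomial σ K s = (s.map X).prod := by
  classical
  rw [← s.toFinsupp_toMultiset, multisetMonomial_toMultiset, monomial_eq, C_1, one_mul,
    Finsupp.toMultiset_map, Finsupp.prod_toMultiset]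
  rw [Finsupp.prod_mapDomain_index (by simp) (by simp [pow_add])]

theorem multisetMonomial_add (s t : Multiset σ) :
    multisetMonomial σ K (s + t) = multisetMonomial σ K s * multisetMonomial σ K t := by
  simp [multisetMonomial_eq_prod]

theorem multisetMonomial_isHomogeneous (s : Multiset σ) :
    (multisetMonomial σ K s).IsHomogeneous s.card := by
  induction s using Multiset.induction with
  | empty => simpa [multisetMonomial_eq_prod] using isHomogeneous_one σ K
  | cons a s ih =>
    rw [← Multiset.singleton_add, multisetMonomial_add, Multiset.card_add]
    exact IsHomogeneous.mul (by simpa [multisetMonomial_eq_prod] using isHomogeneous_X K a) ih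

theorem toricMap_multisetMonomial (A : σ → τ →₀ ℕ) (s : Multiset σ) :
    toricMap K A (multisetMonomial σ K s) = monomial (s.map A).sum 1 := by
  induction s using Multiset.induction with
  | empty => simp [multisetMonomial_eq_prod]
  | cons a s ih =>
    rw [← Multiset.singleton_add, multisetMonomial_add, map_mul, ih]
    simp [multisetMonomial_eq_prod, toricMap, monomial_mul]

theorem toricMap_sub_mem_ker {A : σ → τ →₀ ℕ} {s t : Multiset σ} (h : ToricFiber A s t) :
    multisetMonomial σ K s - multisetMonomial σ K t ∈ RingHom.ker (toricMap K A) := by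
  rw [RingHom.mem_ker, map_sub, toricMap_multisetMonomial, toricMap_multisetMonomial, h, sub_self]

/-- An ideal that contains the binomials of a toric ideal contains the toric ideal. -/
theorem ker_toricMap_le {A : σ → τ →₀ ℕ} {J : Ideal (MvPolynomial σ K)}
    (hJ : ∀ s t, ToricFiber A s t → multisetMonomial σ K s - multisetMonomial σ K t ∈ J) :
    RingHom.ker (toricMap K A) ≤ J := by
  intro f hf
  let g : Multiset σ → τ →₀ ℕ := fun s => (s.map A).sum
  -- Each monomial goes to the class of a chosen preimage; the value off the image of `g` is
  -- irrelevant. Modulo `J` the choice does not matter, so the quotient map factors through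
  -- `toricMap` and kills its kernel.
  let L : MvPolynomial τ K →ₗ[K] MvPolynomial σ K ⧸ J :=
    (basisMonomials τ K).constr K fun n =>
      Ideal.Quotient.mk J (multisetMonomial σ K (Function.invFun g n))
  have hL : L ∘ₗ (toricMap K A).toLinearMap = (Ideal.Quotient.mkₐ K J).toLinearMap := by
    refine (multisetMonomial σ K).ext fun s => ?_
    have h : L (monomial (g s) 1) = _ := (basisMonomials τ K).constr_basis K _ (g s)
    have h' : g (Function.invFun g (g s)) = g s := Function.invFun_eq ⟨s, rfl⟩
    simp only [LinearMap.comp_apply, AlgHom.toLinearMap_apply, toricMap_multisetMonomial]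
    exact h.trans (Ideal.Quotient.eq.2 (hJ _ _ h'))
  have := LinearMap.congr_fun hL f
  simp only [LinearMap.comp_apply, AlgHom.toLinearMap_apply] at this
  rw [RingHom.mem_ker.1 hf, map_zero] at this
  exact Ideal.Quotient.eq_zero_iff_mem.1 this.symm

theorem QuadConn.sub_mem_span {A : σ → τ →₀ ℕ} {s t : Multiset σ}
    (h : QuadConn (ToricFiber A) s t) :
    multisetMonomial σ K s - multisetMonomial σ K t ∈
      Ideal.span {f | f ∈ RingHom.ker (toricMap K A) ∧ f.IsHomogeneous 2} := by
  induction h with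
  | refl => simp
  | tail _ h ih =>
    obtain ⟨r, x, y, hx, hy, h, rfl, rfl⟩ := h
    rw [← sub_add_sub_cancel]
    refine add_mem ih ?_
    rw [multisetMonomial_add, multisetMonomial_add, ← mul_sub]
    refine Ideal.mul_mem_left _ _ (Ideal.subset_span ⟨toricMap_sub_mem_ker h, ?_⟩)
    exact (hx ▸ multisetMonomial_isHomogeneous x).sub (hy ▸ multisetMonomial_isHomogeneous y)

theorem ker_toricMap_eq_span_quadrics {A : σ → τ →₀ ℕ}
    (h : ∀ s t, ToricFiber A s t → QuadConn (ToricFiber A) s t) :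
    RingHom.ker (toricMap K A) =
      Ideal.span {f | f ∈ RingHom.ker (toricMap K A) ∧ f.IsHomogeneous 2} :=
  le_antisymm (ker_toricMap_le fun s t hst => (h s t hst).sub_mem_span)
    (Ideal.span_le.2 fun _ hf => hf.1)

/-- If the toric ideal with injective exponents is generated by forms of degree at most two,
then its fibres are connected by quadratic moves. -/
theorem quadConn_of_ker_eq_span {A : σ → τ →₀ ℕ} (hA : Function.Injective A)
    {S : Set (MvPolynomial σ K)}
    (hS : ∀ f ∈ S, ∃ d ≤ 2, f.IsHomogeneous d) (hspan : Ideal.span S = RingHom.ker (toricMap K A))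
    {s t : Multiset σ} (h : ToricFiber A s t) : QuadConn (ToricFiber A) s t := by
  classical
  let E : Setoid (Multiset σ) :=
    ⟨QuadConn (ToricFiber A), fun _ => .refl, fun h => h.symm fun _ _ => Eq.symm, .trans⟩
  -- Sums the coefficients over each connected component. Once `L` kills the ideal, a binomial in it
  -- must have both terms in one component.
  let L : MvPolynomial σ K →ₗ[K] (Quotient E →₀ K) :=
    (multisetMonomial σ K).constr K fun s => Finsupp.single (Quotient.mk E s) 1
  have hL : ∀ s, L (multisetMonomial σ K s) = Finsupp.single (Quotient.mk E s) 1 :=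
    (multisetMonomial σ K).constr_basis K _
  have hconn : ∀ r x y : Multiset σ, x.card ≤ 2 → x.card = y.card → ToricFiber A x y →
      Quotient.mk E (r + x) = Quotient.mk E (r + y) := by
    intro r x y hx hxy h
    -- In degree below two, injectivity of `A` leaves no nontrivial fibre.
    rcases hx.lt_or_eq with hx | hx
    · suffices x = y by rw [this]
      rcases Nat.lt_or_ge x.card 1 with h0 | h1
      · rw [Multiset.card_eq_zero.1 (show x.card = 0 by omega),
          Multiset.card_eq_zero.1 (show y.card = 0 by omega)]
      · obtain ⟨a, rfl⟩ := Multiset.card_eq_one.1 (show x.card = 1 by omega)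
        obtain ⟨b, rfl⟩ := Multiset.card_eq_one.1 (show y.card = 1 by omega)
        rw [hA (show A a = A b by simpa [ToricFiber] using h)]
    · exact Quotient.sound (.single ⟨r, x, y, hx, by omega, h, rfl, rfl⟩)
  have hgen : ∀ f ∈ S, ∀ r, L (multisetMonomial σ K r * f) = 0 := by
    intro f hf r
    obtain ⟨d, hd, hfd⟩ := hS f hf
    -- A representative of degree `d` in each fibre, with junk value `0`. As `f` is homogeneous of
    -- degree `d ≤ 2`, the component of `r + m` depends only on the fibre of `m`, so `L` on
    -- multiples of `f` factors through `toricMap`.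
    let rep : (τ →₀ ℕ) → Multiset σ := fun n =>
      if h : ∃ s : Multiset σ, s.card = d ∧ (s.map A).sum = n then h.choose else 0
    have hrep : ∀ s : Multiset σ, s.card = d → (rep (s.map A).sum).card = d ∧
        ToricFiber A (rep (s.map A).sum) s := by
      intro s hs
      have hex : ∃ s' : Multiset σ, s'.card = d ∧ (s'.map A).sum = (s.map A).sum := ⟨s, hs, rfl⟩
      simp only [rep, dif_pos hex]
      exact hex.choose_spec
    let L' : MvPolynomial τ K →ₗ[K] (Quotient E →₀ K) :=
      (basisMonomials τ K).constr K fun n => Finsupp.single (Quotient.mk E (r + rep n)) 1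
    have hL' : ∀ n, L' (monomial n 1) = Finsupp.single (Quotient.mk E (r + rep n)) 1 :=
      (basisMonomials τ K).constr_basis K _
    have hker : toricMap K A f = 0 := by
      rw [← RingHom.mem_ker, ← hspan]
      exact Ideal.subset_span hf
    suffices L (multisetMonomial σ K r * f) = L' (toricMap K A f) by rw [this, hker, map_zero]
    have hsum : f = ∑ m ∈ f.support, coeff m f • multisetMonomial σ K (Finsupp.toMultiset m) := by
      conv_lhs => rw [f.as_sum]
      refine Finset.sum_congr rfl fun m _ => ?_
      rw [multisetMonomial_toMultiset, smul_monomial, smul_eq_mul, mul_one]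
    rw [hsum, Finset.mul_sum, map_sum, map_sum, map_sum]
    refine Finset.sum_congr rfl fun m hm => ?_
    have hcard : (Finsupp.toMultiset m).card = d := by
      by_contra hne
      refine mem_support_iff.1 hm (hfd.coeff_eq_zero ?_)
      rwa [Finsupp.card_toMultiset] at hne
    obtain ⟨h₁, h₂⟩ := hrep _ hcard
    rw [mul_smul_comm, map_smul, map_smul, map_smul, ← multisetMonomial_add, hL,
      toricMap_multisetMonomial, hL', hconn r _ _ (by omega) (by omega) h₂]
  have hmul : ∀ f ∈ S, ∀ p, L (p * f) = 0 := by
    intro f hf p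
    have : L ∘ₗ LinearMap.mulRight K f = 0 :=
      (multisetMonomial σ K).ext fun r => by simpa using hgen f hf r
    simpa using LinearMap.congr_fun this p
  have hker : ∀ f ∈ Ideal.span S, ∀ p, L (p * f) = 0 := by
    intro f hf
    induction hf using Submodule.span_induction with
    | mem f hf => exact hmul f hf
    | zero => simp
    | add f g _ _ hf hg => intro p; rw [mul_add, map_add, hf, hg, add_zero]
    | smul q f _ hf => intro p; rw [smul_eq_mul, ← mul_assoc, hf]
  have h0 := hker _ (hspan ▸ toricMap_sub_mem_ker (K := K) h) 1
  rw [one_mul, map_sub, hL, hL, sub_eq_zero] at h0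
  exact Quotient.exact (Finsupp.single_left_injective one_ne_zero h0)

/-- A toric ideal with homogeneous fibres has a minimal set of homogeneous generators. -/
theorem exists_isMinimalHomogeneousGenerators [Finite σ] {A : σ → τ →₀ ℕ}
    (hcard : ∀ s t, ToricFiber A s t → s.card = t.card) :
    ∃ S, IsMinimalHomogeneousGenerators (RingHom.ker (toricMap K A)) S := by
  let B : Set (MvPolynomial σ K) :=
    {f | ∃ s t, ToricFiber A s t ∧ f = multisetMonomial σ K s - multisetMonomial σ K t}
  have hB : Ideal.span B = RingHom.ker (toricMap K A) := by
    refine le_antisymm (Ideal.span_le.2 ?_)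
      (ker_toricMap_le fun s t h => Ideal.subset_span ⟨s, t, h, rfl⟩)
    rintro _ ⟨s, t, h, rfl⟩
    exact toricMap_sub_mem_ker h
  -- Noetherianity gives a finite set of binomial generators, among whose subsets a minimal one can
  -- be chosen.
  obtain ⟨F, hFB, hF⟩ := (Submodule.fg_span_iff_fg_span_finset_subset B).1
    ((isNoetherianRing_iff_ideal_fg _).1 inferInstance (Ideal.span B))
  have hFgen : (∀ f ∈ (F : Set (MvPolynomial σ K)), ∃ d : ℕ, f.IsHomogeneous d) ∧
      Ideal.span (F : Set (MvPolynomial σ K)) = RingHom.ker (toricMap K A) := by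
    refine ⟨fun f hf => ?_, hF.symm.trans hB⟩
    obtain ⟨s, t, h, rfl⟩ := hFB hf
    exact ⟨s.card, (multisetMonomial_isHomogeneous s).sub
      (hcard s t h ▸ multisetMonomial_isHomogeneous t)⟩
  obtain ⟨S, hS⟩ := (F.finite_toSet.finite_subsets.subset
    (fun T hT => hT.1) : ({T | T ⊆ (F : Set (MvPolynomial σ K)) ∧
      (∀ f ∈ T, ∃ d : ℕ, f.IsHomogeneous d) ∧
        Ideal.span T = RingHom.ker (toricMap K A)}).Finite).exists_minimal
    ⟨F, subset_rfl, hFgen⟩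
  exact ⟨S, hS.prop.2, fun T hT hTS => hS.2 ⟨hTS.trans hS.prop.1, hT⟩ hTS⟩

/-- Generators of degree above `n` contribute nothing in degree `n`, where the ideal is generated;
those of degree at most `n` therefore suffice, and minimality excludes the others. -/
theorem totalDegree_le_of_isMinimalHomogeneousGenerators {I : Ideal (MvPolynomial σ K)} {n : ℕ}
    (hI : I = Ideal.span {f | f ∈ I ∧ f.IsHomogeneous n}) {S : Set (MvPolynomial σ K)}
    (hS : IsMinimalHomogeneousGenerators I S) {f : MvPolynomial σ K} (hf : f ∈ S) :
    f.totalDegree ≤ n := by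
  let T : Set (MvPolynomial σ K) := {f ∈ S | f.totalDegree ≤ n}
  have hTS : T ⊆ S := fun f hf => hf.1
  have hcomp : ∀ g ∈ S, ∀ p, homogeneousComponent n (p * g) ∈ Ideal.span T := by
    intro g hg p
    obtain ⟨d, hd⟩ := hS.prop.1 g hg
    rw [← sum_homogeneousComponent p, Finset.sum_mul, map_sum]
    refine sum_mem fun i _ => ?_
    rw [homogeneousComponent_of_mem ((homogeneousComponent_isHomogeneous i p).mul hd)]
    split_ifs with h
    · refine Ideal.mul_mem_left _ _ (Ideal.subset_span ⟨hg, ?_⟩)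
      exact hd.totalDegree_le.trans (by omega)
    · exact zero_mem _
  have hspan : ∀ g ∈ Ideal.span S, ∀ p, homogeneousComponent n (p * g) ∈ Ideal.span T := by
    intro g hg
    induction hg using Submodule.span_induction with
    | mem g hg => exact hcomp g hg
    | zero => simp
    | add f g _ _ hf hg => intro p; rw [mul_add, map_add]; exact add_mem (hf p) (hg p)
    | smul q f _ hf => intro p; rw [smul_eq_mul, ← mul_assoc]; exact hf _
  have hT : Ideal.span T = I := by
    refine le_antisymm ((Ideal.span_mono hTS).trans hS.prop.2.le) ?_
    rw [hI, Ideal.span_le]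
    rintro g ⟨hg, hgn⟩
    have := hspan g (hS.prop.2 ▸ hg) 1
    rwa [one_mul, homogeneousComponent_of_mem hgn, if_pos rfl] at this
  exact (hS.2 ⟨fun f hf => hS.prop.1 f hf.1, hT⟩ hTS hf).2

end Toric

/-! ### Cuts, their fibres and cut ideals. -/

section Cut

variable {V W : Type*}

/-- The cut `A | Aᶜ`. -/
def Cut.ofSet (A : Set V) : Cut V :=
  ⟨s(A, Aᶜ), A, rfl⟩

theorem Cut.ofSet_compl (A : Set V) : Cut.ofSet Aᶜ = Cut.ofSet A :=
  Subtype.ext (by simp [Cut.ofSet, Sym2.eq_swap])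

theorem Cut.exists_mem_ofSet (w : V) (c : Cut V) : ∃ A : Set V, w ∈ A ∧ c = Cut.ofSet A := by
  obtain ⟨_, A, rfl⟩ := c
  by_cases h : w ∈ A
  · exact ⟨A, h, rfl⟩
  · exact ⟨Aᶜ, h, (Cut.ofSet_compl A).symm⟩

theorem Cut.separates_ofSet {A : Set V} {x y : V} :
    (Cut.ofSet A).Separates s(x, y) ↔ ¬(x ∈ A ↔ y ∈ A) := by
  constructor
  · rintro ⟨B, C, h, b, hb, c, hc, he⟩
    simp only [Cut.ofSet, Sym2.eq_iff] at h he
    rcases h with ⟨rfl, rfl⟩ | ⟨rfl, h⟩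
    · rcases he with ⟨rfl, rfl⟩ | ⟨rfl, rfl⟩ <;> simp_all
    · subst h
      rcases he with ⟨rfl, rfl⟩ | ⟨rfl, rfl⟩ <;> simp_all
  · intro h
    by_cases hx : x ∈ A
    · exact ⟨A, Aᶜ, rfl, x, hx, y, fun hy => h (iff_of_true hx hy), rfl⟩
    · exact ⟨A, Aᶜ, rfl, y, by tauto, x, hx, Sym2.eq_swap⟩

theorem Cut.separates_self (c : Cut V) (x : V) : ¬c.Separates s(x, x) := by
  obtain ⟨A, -, rfl⟩ := c.exists_mem_ofSet x
  simp [Cut.separates_ofSet]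

/-- Separation is additive modulo 2 along paths. -/
theorem Cut.separates_trans (c : Cut V) (x y z : V) :
    c.Separates s(x, z) ↔ ¬(c.Separates s(x, y) ↔ c.Separates s(y, z)) := by
  obtain ⟨A, -, rfl⟩ := c.exists_mem_ofSet x
  simp only [Cut.separates_ofSet]
  tauto

theorem Cut.ext_separates {c d : Cut V} (w : V)
    (h : ∀ x, c.Separates s(w, x) ↔ d.Separates s(w, x)) : c = d := by
  obtain ⟨A, hA, rfl⟩ := c.exists_mem_ofSet w
  obtain ⟨B, hB, rfl⟩ := d.exists_mem_ofSet w
  congr 1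
  ext x
  have := h x
  simp only [Cut.separates_ofSet, hA, hB, true_iff] at this
  exact not_iff_not.1 this

/-- The preimage of a cut. -/
def Cut.comap (f : V → W) (c : Cut W) : Cut V :=
  ⟨c.1.map (f ⁻¹' ·), by
    obtain ⟨_, A, rfl⟩ := c
    exact ⟨f ⁻¹' A, rfl⟩⟩

theorem Cut.comap_ofSet (f : V → W) (A : Set W) :
    (Cut.ofSet A).comap f = Cut.ofSet (f ⁻¹' A) := rfl

theorem Cut.separates_comap (f : V → W) (c : Cut W) (e : Sym2 V) :
    (c.comap f).Separates e ↔ c.Separates (e.map f) := by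
  induction e with
  | _ x y =>
  obtain ⟨A, -, rfl⟩ := c.exists_mem_ofSet (f x)
  rw [Cut.comap_ofSet, Sym2.map_mk, Cut.separates_ofSet, Cut.separates_ofSet]
  rfl

open Classical in
/-- Two multisets of cuts have the same size, and the same number of cuts in them separates each
edge in `E`. -/
def CutFiber (E : Set (Sym2 V)) (x y : Multiset (Cut V)) : Prop :=
  x.card = y.card ∧ ∀ e ∈ E, x.countP (·.Separates e) = y.countP (·.Separates e)

theorem CutFiber.equivalence (E : Set (Sym2 V)) : Equivalence (CutFiber E) where
  refl _ := ⟨rfl, fun _ _ => rfl⟩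
  symm h := ⟨h.1.symm, fun e he => (h.2 e he).symm⟩
  trans h h' := ⟨h.1.trans h'.1, fun e he => (h.2 e he).trans (h'.2 e he)⟩

theorem CutFiber.add_left {E : Set (Sym2 V)} (r : Multiset (Cut V)) {x y : Multiset (Cut V)}
    (h : CutFiber E x y) : CutFiber E (r + x) (r + y) :=
  ⟨by simp [h.1], fun e he => by simp [h.2 e he]⟩

-- This is how an added edge $u_iv_i$ enters: it refines the fibres by fixing the number of cuts
-- that separate its ends.
open Classical in
theorem cutFiber_insert (E : Set (Sym2 V)) (e : Sym2 V) :
    CutFiber (insert e E) =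
      fun x y => CutFiber E x y ∧ x.countP (·.Separates e) = y.countP (·.Separates e) := by
  ext x y
  simp only [CutFiber, Set.forall_mem_insert]
  tauto

theorem cutFiber_union (E F : Set (Sym2 V)) (x y : Multiset (Cut V)) :
    CutFiber (E ∪ F) x y ↔ CutFiber E x y ∧ CutFiber F x y := by
  simp only [CutFiber, Set.mem_union, or_imp, forall_and]
  tauto

open Classical in
theorem cutFiber_comap (f : V → W) (E : Set (Sym2 V)) (x y : Multiset (Cut W)) :
    CutFiber E (x.map (Cut.comap f)) (y.map (Cut.comap f)) ↔ CutFiber (Sym2.map f '' E) x y := by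
  have h : ∀ (s : Multiset (Cut W)) (e : Sym2 V), (s.map (Cut.comap f)).countP (·.Separates e) =
      s.countP (·.Separates (e.map f)) := fun s e => by
    rw [Multiset.countP_map, Multiset.countP_eq_card_filter]
    simp only [Cut.separates_comap]
  simp only [CutFiber, Multiset.card_map, Set.forall_mem_image, h]

theorem Multiset.countP_not_iff_modEq {α : Type*} (p q : α → Prop) [DecidablePred p]
    [DecidablePred q] [DecidablePred fun a => ¬(p a ↔ q a)] (s : Multiset α) :
    s.countP (fun a => ¬(p a ↔ q a)) ≡ s.countP p + s.countP q [MOD 2] := by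
  induction s using Multiset.induction with
  | empty => rfl
  | cons a s ih =>
    simp only [Multiset.countP_cons, Nat.ModEq] at *
    by_cases hp : p a <;> by_cases hq : q a <;> simp [hp, hq] <;> omega

open Classical in
/-- In a connected graph, the parity of the number of cuts that separate two given vertices is
constant on fibres. -/
theorem CutFiber.countP_modEq {G : SimpleGraph V} {x y : Multiset (Cut V)}
    (h : CutFiber G.edgeSet x y) {u v : V} (huv : G.Reachable u v) :
    x.countP (·.Separates s(u, v)) ≡ y.countP (·.Separates s(u, v)) [MOD 2] := by
  rw [SimpleGraph.reachable_iff_reflTransGen] at huv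
  induction huv with
  | refl =>
    rw [Multiset.countP_eq_zero.2 fun c _ => c.separates_self u,
      Multiset.countP_eq_zero.2 fun c _ => c.separates_self u]
  | @tail v w _ hvw ih =>
    simp only [Cut.separates_trans _ u v w]
    refine (Multiset.countP_not_iff_modEq _ _ x).trans
      (.trans ?_ (Multiset.countP_not_iff_modEq _ _ y).symm)
    rw [h.2 s(v, w) hvw]
    exact ih.add_right _

theorem Cut.eq_of_separates_edge {G : SimpleGraph V} (hG : G.Connected) {c d : Cut V}
    (h : ∀ e ∈ G.edgeSet, c.Separates e ↔ d.Separates e) : c = d := by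
  obtain ⟨w⟩ := hG.nonempty
  refine Cut.ext_separates w fun x => ?_
  have hx := hG.preconnected w x
  rw [SimpleGraph.reachable_iff_reflTransGen] at hx
  induction hx with
  | refl => exact iff_of_false (c.separates_self w) (d.separates_self w)
  | @tail v x _ hvx ih =>
    rw [c.separates_trans w v x, d.separates_trans w v x, propext ih, propext (h s(v, x) hvx)]

instance Cut.instFinite [Finite V] : Finite (Cut V) :=
  .of_surjective Cut.ofSet fun ⟨_, A, h⟩ => ⟨A, Subtype.ext h.symm⟩

open Classical in
/-- The exponent of the image of the variable `q_c` under `φ_G`. -/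
noncomputable def cutExponent [Finite V] (G : SimpleGraph V) (c : Cut V) :
    (G.edgeSet ⊕ G.edgeSet) →₀ ℕ :=
  ∑ᶠ e : G.edgeSet, Finsupp.single (if c.Separates e.1 then Sum.inl e else Sum.inr e) 1

theorem cutMap_eq_toricMap (K : Type*) [Field K] [Finite V] (G : SimpleGraph V) :
    cutMap K G = toricMap K (cutExponent G) := by
  classical
  have := Fintype.ofFinite G.edgeSet
  unfold cutMap toricMap
  congr 1
  funext c
  rw [cutExponent, finsum_eq_sum_of_fintype, finprod_eq_prod_of_fintype,
    MvPolynomial.monomial_sum_one]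
  refine Finset.prod_congr rfl fun e _ => ?_
  split_ifs <;> rfl

open Classical in
theorem cutExponent_inl [Finite V] (G : SimpleGraph V) (c : Cut V) (e : G.edgeSet) :
    cutExponent G c (Sum.inl e) = if c.Separates e.1 then 1 else 0 := by
  have := Fintype.ofFinite G.edgeSet
  rw [cutExponent, finsum_eq_sum_of_fintype, Finsupp.finsetSum_apply, Finset.sum_eq_single e]
  · split_ifs <;> simp
  · intro f _ hf
    split_ifs <;> simp [hf]
  · simp

open Classical in
theorem cutExponent_inr [Finite V] (G : SimpleGraph V) (c : Cut V) (e : G.edgeSet) :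
    cutExponent G c (Sum.inr e) = if c.Separates e.1 then 0 else 1 := by
  have := Fintype.ofFinite G.edgeSet
  rw [cutExponent, finsum_eq_sum_of_fintype, Finsupp.finsetSum_apply, Finset.sum_eq_single e]
  · split_ifs <;> simp
  · intro f _ hf
    split_ifs <;> simp [hf]
  · simp

/-- The exponents of $s_e$ and $t_e$ count the cuts that do and do not separate $e$. They add up to
the size, which is visible only if there is an edge. -/
theorem toricFiber_cutExponent [Finite V] {G : SimpleGraph V} (hG : G.edgeSet.Nonempty) :
    ToricFiber (cutExponent G) = CutFiber G.edgeSet := by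
  classical
  have hl : ∀ (s : Multiset (Cut V)) (e : G.edgeSet),
      (s.map (cutExponent G)).sum (Sum.inl e) = s.countP (·.Separates e.1) := by
    intro s e
    induction s using Multiset.induction with
    | empty => rfl
    | cons c s ih => simp [Multiset.countP_cons, cutExponent_inl, ih, add_comm]
  have hr : ∀ (s : Multiset (Cut V)) (e : G.edgeSet),
      (s.map (cutExponent G)).sum (Sum.inr e) = s.countP (¬·.Separates e.1) := by
    intro s e
    induction s using Multiset.induction with
    | empty => rfl
    | cons c s ih =>
      simp only [Multiset.map_cons, Multiset.sum_cons, Finsupp.add_apply, cutExponent_inr, ih,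
        Multiset.countP_cons, ite_not, add_comm]
  have hcard : ∀ (s : Multiset (Cut V)) (e : Sym2 V),
      s.card = s.countP (·.Separates e) + s.countP (¬·.Separates e) :=
    fun s e => Multiset.card_eq_countP_add_countP _ s
  ext x y
  constructor
  · intro h
    have hxl : ∀ e ∈ G.edgeSet, x.countP (·.Separates e) = y.countP (·.Separates e) :=
      fun e he => by rw [← hl x ⟨e, he⟩, ← hl y ⟨e, he⟩, h]
    have hxr : ∀ e ∈ G.edgeSet, x.countP (¬·.Separates e) = y.countP (¬·.Separates e) :=
      fun e he => by rw [← hr x ⟨e, he⟩, ← hr y ⟨e, he⟩, h]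
    obtain ⟨e, he⟩ := hG
    exact ⟨by rw [hcard x e, hcard y e, hxl e he, hxr e he], hxl⟩
  · rintro ⟨h, he⟩
    refine Finsupp.ext fun i => ?_
    rcases i with e | e
    · rw [hl, hl, he e.1 e.2]
    · have := he e.1 e.2
      have := hcard x e.1
      have := hcard y e.1
      rw [hr, hr]
      omega

theorem cutExponent_injective [Finite V] {G : SimpleGraph V} (hG : G.Connected) :
    Function.Injective (cutExponent G) := by
  classical
  intro c d h
  refine Cut.eq_of_separates_edge hG fun e he => ?_
  have := DFunLike.congr_fun h (Sum.inl ⟨e, he⟩)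
  rw [cutExponent_inl, cutExponent_inl] at this
  by_cases hc : c.Separates e <;> by_cases hd : d.Separates e <;> simp_all

theorem SimpleGraph.Connected.edgeSet_nonempty {G : SimpleGraph V} (hG : G.Connected) {u v : V}
    (huv : u ≠ v) : G.edgeSet.Nonempty := by
  rw [Set.nonempty_iff_ne_empty, Ne, SimpleGraph.edgeSet_eq_empty]
  rintro rfl
  exact huv (SimpleGraph.reachable_bot.1 (hG.preconnected u v))

theorem quadConn_of_cutMu_le_two (K : Type*) [Field K] [Finite V] {G : SimpleGraph V}
    (hG : G.Connected) (hE : G.edgeSet.Nonempty) (hμ : cutMu K G ≤ 2) (x y : Multiset (Cut V))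
    (h : CutFiber G.edgeSet x y) : QuadConn (CutFiber G.edgeSet) x y := by
  rw [← toricFiber_cutExponent hE] at h ⊢
  have hker : cutIdeal K G = RingHom.ker (toricMap K (cutExponent G)) := by
    rw [cutIdeal, cutMap_eq_toricMap]
  -- `cutMu` is a supremum over minimal generating sets, so its bound yields information only once
  -- such a set exists.
  obtain ⟨S, hS⟩ := exists_isMinimalHomogeneousGenerators (K := K) (A := cutExponent G)
    fun s t h => by
      rw [toricFiber_cutExponent hE] at h
      exact h.1
  refine quadConn_of_ker_eq_span (cutExponent_injective hG) (fun f hf => ?_) hS.prop.2 h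
  have hdeg : (f.totalDegree : ℕ∞) ≤ 2 :=
    (le_iSup₂_of_le S (hker ▸ hS)
      (le_iSup₂_of_le (f := fun f _ => (f.totalDegree : ℕ∞)) f hf le_rfl)).trans hμ
  obtain ⟨d, hd⟩ := hS.prop.1 f hf
  by_cases h0 : f = 0
  · exact ⟨0, by omega, h0 ▸ MvPolynomial.isHomogeneous_zero _ _ _⟩
  · exact ⟨d, hd.totalDegree h0 ▸ by exact_mod_cast hdeg, hd⟩

theorem cutMu_le_two_and_cutIdeal_eq_span (K : Type*) [Field K] [Finite V] {G : SimpleGraph V}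
    (hE : G.edgeSet.Nonempty)
    (h : ∀ x y, CutFiber G.edgeSet x y → QuadConn (CutFiber G.edgeSet) x y) :
    cutMu K G ≤ 2 ∧
      cutIdeal K G = Ideal.span {f | f ∈ cutIdeal K G ∧ f.IsHomogeneous 2} := by
  rw [← toricFiber_cutExponent hE] at h
  have hker : cutIdeal K G = RingHom.ker (toricMap K (cutExponent G)) := by
    rw [cutIdeal, cutMap_eq_toricMap]
  have hspan : cutIdeal K G = Ideal.span {f | f ∈ cutIdeal K G ∧ f.IsHomogeneous 2} := by
    rw [hker]
    exact ker_toricMap_eq_span_quadrics h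
  refine ⟨iSup₂_le fun S hS => iSup₂_le fun f hf => ?_, hspan⟩
  exact_mod_cast totalDegree_le_of_isMinimalHomogeneousGenerators hspan hS hf

end Cut

/-! ### Cuts and edges of the glued graph. -/

section Glue

variable {V₁ V₂ : Type*} {u₁ v₁ : V₁} {u₂ v₂ : V₂}

/-- The map of the first vertex set to the glued vertex set. -/
def GlueVertex.inl (u₁ v₁ : V₁) (u₂ v₂ : V₂) (x : V₁) : GlueVertex u₁ v₁ u₂ v₂ :=
  Quot.mk _ (Sum.inl x)

/-- The map of the second vertex set to the glued vertex set. -/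
def GlueVertex.inr (u₁ v₁ : V₁) (u₂ v₂ : V₂) (x : V₂) : GlueVertex u₁ v₁ u₂ v₂ :=
  Quot.mk _ (Sum.inr x)

theorem GlueVertex.inl_u : inl u₁ v₁ u₂ v₂ u₁ = inr u₁ v₁ u₂ v₂ u₂ := Quot.sound .left

theorem GlueVertex.inl_v : inl u₁ v₁ u₂ v₂ v₁ = inr u₁ v₁ u₂ v₂ v₂ := Quot.sound .right

theorem isPropFiberProduct_glue (u₁ v₁ : V₁) (u₂ v₂ : V₂) :
    IsPropFiberProduct (Cut.comap (GlueVertex.inl u₁ v₁ u₂ v₂))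
      (Cut.comap (GlueVertex.inr u₁ v₁ u₂ v₂)) (·.Separates s(u₁, v₁)) (·.Separates s(u₂, v₂)) where
  compat c := by
    rw [Cut.separates_comap, Cut.separates_comap, Sym2.map_mk, Sym2.map_mk, GlueVertex.inl_u,
      GlueVertex.inl_v]
  exists_lift a b h := by
    -- Choosing the sides that contain `u₁` and `u₂` makes them agree at the first glued vertex; `h`
    -- then says that they agree at the second.
    obtain ⟨A, hA, rfl⟩ := a.exists_mem_ofSet u₁
    obtain ⟨B, hB, rfl⟩ := b.exists_mem_ofSet u₂
    simp only [Cut.separates_ofSet, hA, hB, true_iff, not_iff_not] at h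
    let C : Set (GlueVertex u₁ v₁ u₂ v₂) :=
      Quot.lift (Sum.elim (· ∈ A) (· ∈ B)) (by
        rintro _ _ (_ | _)
        · simp [hA, hB]
        · simpa using h)
    exact ⟨Cut.ofSet C, rfl, rfl⟩
  injective c d h₁ h₂ := by
    refine Cut.ext_separates (GlueVertex.inl u₁ v₁ u₂ v₂ u₁) fun x => ?_
    rcases x with ⟨x | x⟩
    · exact ((Cut.separates_comap _ c s(u₁, x)).symm.trans (by rw [h₁])).trans
        (Cut.separates_comap _ d s(u₁, x))
    · rw [GlueVertex.inl_u]
      exact ((Cut.separates_comap _ c s(u₂, x)).symm.trans (by rw [h₂])).trans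
        (Cut.separates_comap _ d s(u₂, x))

theorem GlueVertex.inl_injective (h : u₂ ≠ v₂) :
    Function.Injective (inl u₁ v₁ u₂ v₂) := by
  classical
  -- A retraction that collapses the second vertex set onto `u₁` and `v₁`.
  let ρ : GlueVertex u₁ v₁ u₂ v₂ → V₁ :=
    Quot.lift (Sum.elim id fun y => if y = u₂ then u₁ else v₁) (by
      rintro _ _ (_ | _) <;> simp [h.symm])
  exact Function.LeftInverse.injective (g := ρ) fun _ => rfl

theorem GlueVertex.inr_injective (h : u₁ ≠ v₁) :
    Function.Injective (inr u₁ v₁ u₂ v₂) := by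
  classical
  let ρ : GlueVertex u₁ v₁ u₂ v₂ → V₂ :=
    Quot.lift (Sum.elim (fun x => if x = u₁ then u₂ else v₂) id) (by
      rintro _ _ (_ | _) <;> simp [h.symm])
  exact Function.LeftInverse.injective (g := ρ) fun _ => rfl

theorem edgeSet_glueGraph (H₁ : SimpleGraph V₁) (H₂ : SimpleGraph V₂)
    (hne₁ : u₁ ≠ v₁) (hne₂ : u₂ ≠ v₂) :
    (glueGraph H₁ H₂ u₁ v₁ u₂ v₂).edgeSet =
      Sym2.map (GlueVertex.inl u₁ v₁ u₂ v₂) '' H₁.edgeSet ∪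
        Sym2.map (GlueVertex.inr u₁ v₁ u₂ v₂) '' H₂.edgeSet := by
  ext e
  constructor
  · induction e with
    | _ a b =>
    rintro ⟨-, x | x, y | y, h, rfl, rfl⟩
    · exact .inl ⟨s(x, y), h, rfl⟩
    · exact absurd h (by simp)
    · exact absurd h (by simp)
    · exact .inr ⟨s(x, y), h, rfl⟩
  · rintro (⟨e, he, rfl⟩ | ⟨e, he, rfl⟩)
    · induction e with
      | _ x y =>
      exact SimpleGraph.map_adj_apply' (G := SimpleGraph.sum H₁ H₂) (u := Sum.inl x)
        (v := Sum.inl y) he ((GlueVertex.inl_injective hne₂).ne (SimpleGraph.Adj.ne he))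
    · induction e with
      | _ x y =>
      exact SimpleGraph.map_adj_apply' (G := SimpleGraph.sum H₁ H₂) (u := Sum.inr x)
        (v := Sum.inr y) he ((GlueVertex.inr_injective hne₁).ne (SimpleGraph.Adj.ne he))

end Glue

theorem mainTheorem3 (K : Type*) [Field K] {V₁ V₂ : Type*} [Finite V₁] [Finite V₂]
    (H₁ : SimpleGraph V₁) (H₂ : SimpleGraph V₂) (u₁ v₁ : V₁) (u₂ v₂ : V₂)
    (hne₁ : u₁ ≠ v₁) (hadj₁ : ¬ H₁.Adj u₁ v₁)
    (hne₂ : u₂ ≠ v₂) (hadj₂ : ¬ H₂.Adj u₂ v₂)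
    (hconn₁ : H₁.Connected) (hconn₂ : H₂.Connected)
    (hμ₁ : cutMu K H₁ ≤ 2) (hμ₂ : cutMu K H₂ ≤ 2)
    (hμe₁ : cutMu K (H₁ ⊔ SimpleGraph.edge u₁ v₁) ≤ 2)
    (hμe₂ : cutMu K (H₂ ⊔ SimpleGraph.edge u₂ v₂) ≤ 2) :
    cutMu K (glueGraph H₁ H₂ u₁ v₁ u₂ v₂) ≤ 2 ∧
      cutIdeal K (glueGraph H₁ H₂ u₁ v₁ u₂ v₂) =
        Ideal.span {f | f ∈ cutIdeal K (glueGraph H₁ H₂ u₁ v₁ u₂ v₂) ∧ f.IsHomogeneous 2} := by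
  classical
  have hE := edgeSet_glueGraph H₁ H₂ hne₁ hne₂
  have hE₁ := hconn₁.edgeSet_nonempty hne₁
  have hE₂ := hconn₂.edgeSet_nonempty hne₂
  have hc₁' := quadConn_of_cutMu_le_two K (hconn₁.mono le_sup_left)
    (hE₁.mono (SimpleGraph.edgeSet_mono le_sup_left)) hμe₁
  have hc₂' := quadConn_of_cutMu_le_two K (hconn₂.mono le_sup_left)
    (hE₂.mono (SimpleGraph.edgeSet_mono le_sup_left)) hμe₂
  -- Connectedness for $H_i+u_iv_i$ becomes connectedness for $H_i$ with the count of separating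
  -- cuts fixed.
  rw [SimpleGraph.edgeSet_sup, SimpleGraph.edgeSet_edge_of_ne hne₁, Set.union_singleton,
    cutFiber_insert] at hc₁'
  rw [SimpleGraph.edgeSet_sup, SimpleGraph.edgeSet_edge_of_ne hne₂, Set.union_singleton,
    cutFiber_insert] at hc₂'
  refine cutMu_le_two_and_cutIdeal_eq_span K ?_ fun x y h =>
    QuadConn.fiberProduct (isPropFiberProduct_glue u₁ v₁ u₂ v₂)
      (CutFiber.equivalence H₁.edgeSet) (CutFiber.equivalence H₂.edgeSet)
      (fun r _ _ h => h.add_left r) (fun r _ _ h => h.add_left r)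
      (fun _ _ h => h.countP_modEq (hconn₁.preconnected u₁ v₁))
      (fun _ _ h => h.countP_modEq (hconn₂.preconnected u₂ v₂))
      (fun x y => by rw [hE, cutFiber_union, cutFiber_comap, cutFiber_comap])
      (quadConn_of_cutMu_le_two K hconn₁ hE₁ hμ₁) (quadConn_of_cutMu_le_two K hconn₂ hE₂ hμ₂)
      (fun x y h h' => hc₁' x y ⟨h, h'⟩) (fun x y h h' => hc₂' x y ⟨h, h'⟩) h
  rw [hE]
  exact (hE₁.image _).inl
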